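/- Let $\Bbbk$ be an algebraically closed field and let $\mathcal C$ be a symmetric tensor category over $\Bbbk$, that is, a $\Bbbk$-linear abelian rigid symmetric monoidal category with $\Bbbk$-bilinear tensor product and $\dim_\Bbbk \operatorname{End}(\mathbf 1)=1$. Write $c$ for the symmetry, $V^*$ for the dual of $V$, $\mathrm{coev}_V\colon\mathbf 1\to V\otimes V^*$ and $\mathrm{ev}_V\colon V^*\otimes V\to\mathbf 1$ for the duality morphisms, and also $\mathrm{ev}_V\colon V\otimes V^*\to\mathbf 1$ for the composite with $c_{V,V^*}$; associativity isomorphisms are suppressed. Let $(X,b)$ be an operadic Lie algebra in $\mathcal C$ (in particular, any Lie algebra in $\mathcal C$), i.e. $b\colon X\otimes X\to X$ satisfies $b(\mathrm{id}+c_{X,X})=0$ and $b(b\otimes\mathrm{id})(\mathrm{id}+(123)+(132))=0$. An $X$-module is a morphism $\rho\colon X\otimes V\to V$ with $\rho(b\otimes\mathrm{id}_V)=\rho(\mathrm{id}_X\otimes\rho)((\mathrm{id}-c_{X,X})\otimes\mathrm{id}_V)$; its dual module is $\rho^\vee=(\mathrm{ev}_V\otimes\mathrm{id})(\mathrm{id}\otimes(-\rho)\otimes\mathrm{id})(c_{X,V^*}\otimes\mathrm{coev}_V)\colon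 X\otimes V^*\to V^*$. A *symmetrizable datum* over $X$ is a pair $(\rho,K)$ in which * $\rho\colon X\otimes V\to V$ is an $X$-module such that $\rho|_{X\otimes S}\neq0$ for every simple subobject $S\subseteq V$ and $\pi\rho\neq0$ for every epimorphism $\pi\colon V\to T$ onto a simple object $T$; * $K\colon X\otimes X\to\mathbf 1$ is symmetric ($Kc_{X,X}=K$), invariant ($K(b\otimes\mathrm{id})=K(\mathrm{id}\otimes b)$) and non-degenerate (the morphism $\psi_K=(K\otimes\mathrm{id}_{X^*})(\mathrm{id}_X\otimes\mathrm{coev}_X)\colon X\to X^*$ is an isomorphism). For such a pair, $d_{\rho,K}\colon V\otimes V^*\to X$ denotes the image of $\rho$ under $$\operatorname{Hom}(X\otimes V,V)\xrightarrow{\ *\ }\operatorname{Hom}(V^*,V^*\otimes X^*)\cong\operatorname{Hom}(V\otimes V^*,X^*)\cong\operatorname{Hom}(V\otimes V^*,X),$$ given by dualization, the duality adjunction, and composition with $\psi_K^{-1}$. **Lemma.** If $(\rho,K)$ is a symmetrizable datum over $X$ and $d=d_{\rho,K}$, then $(\rho,d)$ is a reduced contragredient datum over $X$. That is, $\rho$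 is an $X$-module, $$b(\mathrm{id}_X\otimes d)=d(\rho\otimes\mathrm{id}_{V^*})+d(\mathrm{id}_V\otimes\rho^\vee)(c_{X,V}\otimes\mathrm{id}_{V^*}),$$ and $d|_{S\otimes V^*}\neq0$ and $d|_{V\otimes T}\neq0$ for all simple subobjects $S\subseteq V$ and $T\subseteq V^*$. Moreover, $d_{\rho,K}$ is the unique morphism $d\colon V\otimes V^*\to X$ with $K(\mathrm{id}_X\otimes d)=\mathrm{ev}_V(\rho\otimes\mathrm{id}_{V^*})$. -/

import Mathlib

open CategoryTheory MonoidalCategory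

noncomputable section

namespace Contragredient

universe v u

section Monoidal

variable {C : Type u} [Category.{v} C] [MonoidalCategory C] [SymmetricCategory C] [RigidCategory C]

/-- The evaluation `V ⊗ V* ⟶ 𝟙`, i.e. the evaluation `V* ⊗ V ⟶ 𝟙` precomposed with the symmetry.
The dual `V*` is Mathlib's `Vᘁ`, with `ε_ V Vᘁ : V* ⊗ V ⟶ 𝟙` and `η_ V Vᘁ : 𝟙 ⟶ V ⊗ V*`. -/
def evSwap (V : C) : V ⊗ Vᘁ ⟶ 𝟙_ C :=
  (β_ V (Vᘁ)).hom ≫ ε_ V (Vᘁ)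

/-- The morphism `X ⟶ X*` induced by a bilinear form `K : X ⊗ X ⟶ 𝟙`, i.e. `x ↦ K(x, -)`. -/
def formToDual {X : C} (K : X ⊗ X ⟶ 𝟙_ C) : X ⟶ Xᘁ :=
  (ρ_ X).inv ≫ X ◁ η_ X (Xᘁ) ≫ (α_ X X (Xᘁ)).inv ≫ K ▷ Xᘁ ≫ (λ_ (Xᘁ)).hom

/-- The dual `V* ⟶ (X ⊗ V)* ≅ V* ⊗ X*` of a morphism `X ⊗ V ⟶ V`. -/
def dualAction {X V : C} (ρ : X ⊗ V ⟶ V) : Vᘁ ⟶ Vᘁ ⊗ Xᘁ :=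
  ρᘁ ≫ (rightDualTensorIso X V).hom

/-- The morphism `V ⊗ V* ⟶ X*` that corresponds to the dual `V* ⟶ V* ⊗ X*` of `ρ` under the
duality adjunction `Hom(V*, V* ⊗ X*) ≅ Hom(V ⊗ V*, X*)`. -/
def toDual {X V : C} (ρ : X ⊗ V ⟶ V) : V ⊗ Vᘁ ⟶ Xᘁ :=
  V ◁ dualAction ρ ≫ (α_ V (Vᘁ) (Xᘁ)).inv ≫ evSwap V ▷ Xᘁ ≫ (λ_ (Xᘁ)).hom

end Monoidal

variable {C : Type u} [Category.{v} C] [Preadditive C] [MonoidalCategory C] [SymmetricCategory C]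

/-- The cyclic permutation `x ⊗ y ⊗ z ↦ z ⊗ x ⊗ y` of `X ⊗ X ⊗ X`. -/
def cyclic (X : C) : (X ⊗ X) ⊗ X ⟶ (X ⊗ X) ⊗ X :=
  (β_ (X ⊗ X) X).hom ≫ (α_ X X X).inv

variable (C) in
/-- An operadic Lie algebra in a symmetric category: an object with an antisymmetric bracket that
satisfies the Jacobi identity. -/
structure OperadicLieAlgebra where
  /-- the underlying object -/
  obj : C
  /-- the bracket -/
  bracket : obj ⊗ obj ⟶ obj
  antisymmetry : (𝟙 (obj ⊗ obj) + (β_ obj obj).hom) ≫ bracket = 0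
  jacobi : (𝟙 ((obj ⊗ obj) ⊗ obj) + cyclic obj + cyclic obj ≫ cyclic obj) ≫
    bracket ▷ obj ≫ bracket = 0

/-- `ρ : X ⊗ V ⟶ V` is a module over the operadic Lie algebra `X`:
`[x, y] v = x (y v) - y (x v)`. -/
def IsModule (X : OperadicLieAlgebra C) {V : C} (ρ : X.obj ⊗ V ⟶ V) : Prop :=
  X.bracket ▷ V ≫ ρ =
    (𝟙 (X.obj ⊗ X.obj) - (β_ X.obj X.obj).hom) ▷ V ≫ (α_ X.obj X.obj V).hom ≫ X.obj ◁ ρ ≫ ρ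

variable [RigidCategory C]

/-- The dual action `X ⊗ V* ⟶ V*`, namely the composite
`X ⊗ V* ⟶ V* ⊗ X ⊗ V ⊗ V* ⟶ V* ⊗ V ⊗ V* ⟶ V*` of the symmetry tensored with the coevaluation,
`-ρ`, and the evaluation. -/
def coAction {X V : C} (ρ : X ⊗ V ⟶ V) : X ⊗ Vᘁ ⟶ Vᘁ :=
  (β_ X (Vᘁ)).hom ≫ (ρ_ (Vᘁ ⊗ X)).inv ≫ (Vᘁ ⊗ X) ◁ η_ V (Vᘁ) ≫
    (α_ (Vᘁ) X (V ⊗ Vᘁ)).hom ≫ Vᘁ ◁ (α_ X V (Vᘁ)).inv ≫ Vᘁ ◁ ((-ρ) ▷ Vᘁ) ≫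
    (α_ (Vᘁ) V (Vᘁ)).inv ≫ ε_ V (Vᘁ) ▷ Vᘁ ≫ (λ_ (Vᘁ)).hom

/-- A contragredient datum over `X`: an `X`-module `ρ : X ⊗ V ⟶ V` and a morphism
`d : V ⊗ V* ⟶ X` such that `[x, d(v ⊗ f)] = d(x v ⊗ f) + d(v ⊗ x f)`. -/
structure IsContragredientDatum (X : OperadicLieAlgebra C) {V : C}
    (ρ : X.obj ⊗ V ⟶ V) (d : V ⊗ Vᘁ ⟶ X.obj) : Prop where
  isModule : IsModule X ρ
  compatible : X.obj ◁ d ≫ X.bracket =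
    (α_ X.obj V (Vᘁ)).inv ≫ ρ ▷ Vᘁ ≫ d +
      (α_ X.obj V (Vᘁ)).inv ≫ (β_ X.obj V).hom ▷ Vᘁ ≫ (α_ V X.obj (Vᘁ)).hom ≫
        V ◁ coAction ρ ≫ d

/-- A contragredient datum is reduced if `d` restricts to a nonzero morphism on `S ⊗ V*` and on
`V ⊗ T`, for all simple subobjects `S` of `V` and `T` of `V*`. -/
structure IsReducedContragredientDatum (X : OperadicLieAlgebra C) {V : C}
    (ρ : X.obj ⊗ V ⟶ V) (d : V ⊗ Vᘁ ⟶ X.obj) : Prop extends IsContragredientDatum X ρ d where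
  restrict_left : ∀ (S : C) [Simple S] (i : S ⟶ V) [Mono i], i ▷ Vᘁ ≫ d ≠ 0
  restrict_right : ∀ (T : C) [Simple T] (j : T ⟶ Vᘁ) [Mono j], V ◁ j ≫ d ≠ 0

/-- A symmetrizable datum over `X`: an `X`-module `ρ : X ⊗ V ⟶ V` that does not vanish on `X ⊗ S`
for a simple subobject `S` of `V`, nor after projecting to a simple quotient `T` of `V`, and a
symmetric non-degenerate invariant form `K` on `X`. -/
structure IsSymmetrizableDatum (X : OperadicLieAlgebra C) {V : C}
    (ρ : X.obj ⊗ V ⟶ V) (K : X.obj ⊗ X.obj ⟶ 𝟙_ C) : Prop where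
  isModule : IsModule X ρ
  simple_sub : ∀ (S : C) [Simple S] (i : S ⟶ V) [Mono i], X.obj ◁ i ≫ ρ ≠ 0
  simple_quotient : ∀ (T : C) [Simple T] (p : V ⟶ T) [Epi p], ρ ≫ p ≠ 0
  symmetric : (β_ X.obj X.obj).hom ≫ K = K
  nondegenerate : IsIso (formToDual K)
  invariant : X.bracket ▷ X.obj ≫ K =
    (α_ X.obj X.obj X.obj).hom ≫ X.obj ◁ X.bracket ≫ K

/-- The morphism `d_{ρ,K} : V ⊗ V* ⟶ X`: the image of `ρ` under
`Hom(X ⊗ V, V) ⟶ Hom(V*, V* ⊗ X*) ≅ Hom(V ⊗ V*, X*) ≅ Hom(V ⊗ V*, X)`, the last map being the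
composition with the inverse of the isomorphism `X ⟶ X*` induced by `K`. -/
def IsSymmetrizableDatum.d {X : OperadicLieAlgebra C} {V : C} {ρ : X.obj ⊗ V ⟶ V}
    {K : X.obj ⊗ X.obj ⟶ 𝟙_ C} (h : IsSymmetrizableDatum X ρ K) : V ⊗ Vᘁ ⟶ X.obj :=
  haveI := h.nondegenerate
  toDual ρ ≫ inv (formToDual K)

end Contragredient

end

/-! Everything is tested by evaluation. The defining property is `K(x, d(v ⊗ f)) = ev(xv ⊗ f)`
(`form_d`), and since `K` is non-degenerate and symmetric, `K(x, -)` determines a morphism into `X`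
(`form_injective`); uniqueness follows at once. For compatibility, pair both sides with `y`: by
invariance the bracket gives `ev([y,x]v ⊗ f)`, the two terms on the right give `ev(yxv ⊗ f)` and
`-ev(xyv ⊗ f)` (`coAction_evSwap`), and the module identity equates them. For reducedness, vanishing
of `d` on `S ⊗ V*` forces `ρ` to vanish on `X ⊗ S`, while a simple `T ⊆ V*` is the transpose of a
simple quotient of `V`, to which the quotient condition applies. -/

namespace Contragredient

universe v u

/-! ### Evaluation determines a morphism into either member of a dual pair. -/

section Pairing

variable {C : Type u} [Category.{v} C] [MonoidalCategory C]

theorem whiskerRight_evaluation_injective {A X Y : C} [ExactPairing X Y] {f g : A ⟶ Y}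
    (h : f ▷ X ≫ ε_ X Y = g ▷ X ≫ ε_ X Y) : f = g := by
  let _ : HasRightDual X := ⟨Y⟩
  have h' := congrArg (tensorRightHomEquiv A X Y (𝟙_ C)) h
  erw [tensorRightHomEquiv_whiskerRight_comp_evaluation,
    tensorRightHomEquiv_whiskerRight_comp_evaluation] at h'
  simpa using h'

theorem whiskerLeft_evaluation_injective {A X Y : C} [ExactPairing X Y] {f g : A ⟶ X}
    (h : Y ◁ f ≫ ε_ X Y = Y ◁ g ≫ ε_ X Y) : f = g := by
  let _ : HasLeftDual Y := ⟨X⟩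
  have h' := congrArg (tensorLeftHomEquiv A X Y (𝟙_ C)) h
  erw [tensorLeftHomEquiv_whiskerLeft_comp_evaluation,
    tensorLeftHomEquiv_whiskerLeft_comp_evaluation] at h'
  simpa using h'

/-- A morphism `A ⊗ X ⟶ 𝟙` is recovered by evaluating its transpose. -/
theorem transpose_evaluation {A X Y : C} [ExactPairing X Y] (K : A ⊗ X ⟶ 𝟙_ C) :
    ((ρ_ A).inv ≫ A ◁ η_ X Y ≫ (α_ A X Y).inv ≫ K ▷ Y ≫ (λ_ Y).hom) ▷ X ≫ ε_ X Y = K := by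
  calc
    _ = 𝟙 _ ⊗≫ A ◁ η_ X Y ▷ X ⊗≫ (K ▷ (Y ⊗ X) ≫ 𝟙_ C ◁ ε_ X Y) ⊗≫ 𝟙 _ := by monoidal
    _ = 𝟙 _ ⊗≫ A ◁ (η_ X Y ▷ X ⊗≫ X ◁ ε_ X Y) ⊗≫ K := by
      rw [← whisker_exchange]; monoidal
    _ = K := by rw [ExactPairing.evaluation_coevaluation'']; monoidal

end Pairing

/-! ### Evaluations of the transposed action and of the dual action. -/

section Form

variable {C : Type u} [Category.{v} C] [MonoidalCategory C] [RigidCategory C]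

theorem formToDual_evaluation {X : C} (K : X ⊗ X ⟶ 𝟙_ C) :
    formToDual K ▷ X ≫ ε_ X Xᘁ = K :=
  transpose_evaluation K

theorem dualAction_evaluation {X V : C} (ρ : X ⊗ V ⟶ V) :
    dualAction ρ ▷ (X ⊗ V) ≫ ε_ (X ⊗ V) (Vᘁ ⊗ Xᘁ) = Vᘁ ◁ ρ ≫ ε_ V Vᘁ := by
  -- `rightDualTensorIso` is the mate of the identity for two right duals of `X ⊗ V`, so it
  -- intertwines their evaluations.
  have h := @rightAdjointMate_comp_evaluation C _ _ (X ⊗ V) (X ⊗ V) ⟨Vᘁ ⊗ Xᘁ⟩ inferInstance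
    (𝟙 (X ⊗ V))
  rw [← rightAdjointMate_comp_evaluation, dualAction, comp_whiskerRight, Category.assoc]
  congr 1
  refine h.trans ?_
  rw [whiskerLeft_id, Category.id_comp]

variable [SymmetricCategory C]

theorem evSwap_injective {A V : C} {f g : A ⟶ V}
    (h : f ▷ Vᘁ ≫ evSwap V = g ▷ Vᘁ ≫ evSwap V) : f = g := by
  simp only [evSwap, BraidedCategory.braiding_naturality_left_assoc] at h
  exact whiskerLeft_evaluation_injective ((cancel_epi _).1 h)

theorem toDual_evaluation {X V : C} (ρ : X ⊗ V ⟶ V) :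
    toDual ρ ▷ X ≫ ε_ X Xᘁ =
      (β_ (V ⊗ Vᘁ) X).hom ≫ (α_ X V Vᘁ).inv ≫ ρ ▷ Vᘁ ≫ evSwap V := by
  calc
    _ = 𝟙 _ ⊗≫ V ◁ dualAction ρ ▷ X ⊗≫ (β_ V Vᘁ).hom ▷ (Xᘁ ⊗ X) ⊗≫ (ε_ V Vᘁ ▷ (Xᘁ ⊗ X) ≫
          𝟙_ C ◁ ε_ X Xᘁ) ⊗≫ 𝟙 _ := by
      simp only [toDual, evSwap]; monoidal
    _ = 𝟙 _ ⊗≫ V ◁ dualAction ρ ▷ X ⊗≫ ((β_ V Vᘁ).hom ▷ (Xᘁ ⊗ X) ≫ (Vᘁ ⊗ V) ◁ ε_ X Xᘁ) ⊗≫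
          ε_ V Vᘁ := by
      rw [← whisker_exchange]; monoidal
    _ = (α_ V Vᘁ X).hom ≫ V ◁ (dualAction ρ ▷ X ⊗≫ Vᘁ ◁ ε_ X Xᘁ ⊗≫ 𝟙 _) ≫ (β_ V Vᘁ).hom ≫ ε_ V Vᘁ := by
      rw [← whisker_exchange]; monoidal
    _ = (α_ V Vᘁ X).hom ≫ (β_ V (Vᘁ ⊗ X)).hom ≫ (α_ Vᘁ X V).hom ≫ dualAction ρ ▷ (X ⊗ V) ≫
          ε_ (X ⊗ V) (Vᘁ ⊗ Xᘁ) := by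
      rw [BraidedCategory.braiding_naturality_right_assoc]
      -- The evaluation of `X ⊗ V` is nested: first `X`, then `V`.
      simp only [ExactPairing.tensor_evaluation]
      monoidal
    _ = _ := by
      rw [dualAction_evaluation, evSwap, BraidedCategory.braiding_naturality_left_assoc]
      simp [BraidedCategory.braiding_tensor_left_hom, BraidedCategory.braiding_tensor_right_hom,
        ← BraidedCategory.yang_baxter_assoc, ← comp_whiskerRight_assoc]

theorem coAction_evaluation [Preadditive C] [MonoidalPreadditive C] {X V : C} (ρ : X ⊗ V ⟶ V) :
    coAction ρ ▷ V ≫ ε_ V Vᘁ =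
      -((β_ X Vᘁ).hom ▷ V ≫ (α_ Vᘁ X V).hom ≫ Vᘁ ◁ ρ ≫ ε_ V Vᘁ) := by
  have h := transpose_evaluation (X := V) (Y := Vᘁ) ((α_ Vᘁ X V).hom ≫ Vᘁ ◁ (-ρ) ≫ ε_ V Vᘁ)
  calc
    _ = (β_ X Vᘁ).hom ▷ V ≫ ((ρ_ (Vᘁ ⊗ X)).inv ≫ (Vᘁ ⊗ X) ◁ η_ V Vᘁ ≫ (α_ (Vᘁ ⊗ X) V Vᘁ).inv ≫
        ((α_ Vᘁ X V).hom ≫ Vᘁ ◁ (-ρ) ≫ ε_ V Vᘁ) ▷ Vᘁ ≫ (λ_ Vᘁ).hom) ▷ V ≫ ε_ V Vᘁ := by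
      simp only [coAction]; monoidal
    _ = _ := by
      rw [h, show Vᘁ ◁ (-ρ) = -(Vᘁ ◁ ρ) from (tensorLeft Vᘁ).map_neg]
      simp

/-- Invariance of evaluation: `ev(v ⊗ xf) = -ev(xv ⊗ f)`. -/
theorem coAction_evSwap [Preadditive C] [MonoidalPreadditive C] {X V : C} (ρ : X ⊗ V ⟶ V) :
    (β_ X V).hom ▷ Vᘁ ≫ (α_ V X Vᘁ).hom ≫ V ◁ coAction ρ ≫ evSwap V =
      -(ρ ▷ Vᘁ ≫ evSwap V) := by
  rw [evSwap, BraidedCategory.braiding_naturality_right_assoc, coAction_evaluation,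
    BraidedCategory.braiding_naturality_left_assoc]
  simp [BraidedCategory.braiding_tensor_left_hom, BraidedCategory.braiding_tensor_right_hom,
    ← comp_whiskerRight_assoc]

end Form

/-! ### Transposition exchanges monos with epis and preserves simplicity. -/

section Dual

variable {C : Type u} [Category.{v} C] [MonoidalCategory C]

/-- The transpose of a morphism between first members of exact pairings. -/
theorem exists_transpose_left {X X' Y Y' : C} [ExactPairing X X'] [ExactPairing Y Y']
    (f : X ⟶ Y) : ∃ g : Y' ⟶ X', g ▷ X ≫ ε_ X X' = Y' ◁ f ≫ ε_ Y Y' := by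
  let _ : HasRightDual X := ⟨X'⟩
  let _ : HasRightDual Y := ⟨Y'⟩
  exact ⟨_, rightAdjointMate_comp_evaluation f⟩

/-- The transpose of a morphism between second members of exact pairings. -/
theorem exists_transpose_right {X X' Y Y' : C} [ExactPairing X X'] [ExactPairing Y Y']
    (g : Y' ⟶ X') : ∃ f : X ⟶ Y, g ▷ X ≫ ε_ X X' = Y' ◁ f ≫ ε_ Y Y' := by
  let _ : HasLeftDual X' := ⟨X⟩
  let _ : HasLeftDual Y' := ⟨Y⟩
  exact ⟨_, (leftAdjointMate_comp_evaluation g).symm⟩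

theorem transpose_comp {X X' Y Y' Z Z' : C} [ExactPairing X X'] [ExactPairing Y Y']
    [ExactPairing Z Z'] {f : X ⟶ Y} {f' : Y' ⟶ X'} {g : Y ⟶ Z} {g' : Z' ⟶ Y'}
    (hf : f' ▷ X ≫ ε_ X X' = Y' ◁ f ≫ ε_ Y Y') (hg : g' ▷ Y ≫ ε_ Y Y' = Z' ◁ g ≫ ε_ Z Z') :
    (g' ≫ f') ▷ X ≫ ε_ X X' = Z' ◁ (f ≫ g) ≫ ε_ Z Z' := by
  rw [comp_whiskerRight, Category.assoc, hf, ← whisker_exchange_assoc, hg,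
    MonoidalCategory.whiskerLeft_comp, Category.assoc]

theorem isIso_of_isIso_transpose {X X' Y Y' : C} [ExactPairing X X'] [ExactPairing Y Y']
    {f : X ⟶ Y} {g : Y' ⟶ X'} (h : g ▷ X ≫ ε_ X X' = Y' ◁ f ≫ ε_ Y Y') [IsIso g] : IsIso f := by
  obtain ⟨k, hk⟩ := exists_transpose_right (X := Y) (Y := X) (inv g)
  refine ⟨k, ?_, ?_⟩
  · apply whiskerLeft_evaluation_injective (Y := X')
    rw [← transpose_comp h hk]; simp
  · apply whiskerLeft_evaluation_injective (Y := Y')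
    rw [← transpose_comp hk h]; simp

variable [Preadditive C] [MonoidalPreadditive C]

theorem transpose_eq_zero_iff {X X' Y Y' : C} [ExactPairing X X'] [ExactPairing Y Y']
    {f : X ⟶ Y} {g : Y' ⟶ X'} (h : g ▷ X ≫ ε_ X X' = Y' ◁ f ≫ ε_ Y Y') : f = 0 ↔ g = 0 := by
  constructor
  · rintro rfl
    apply whiskerRight_evaluation_injective (X := X)
    rw [h]; simp
  · rintro rfl
    apply whiskerLeft_evaluation_injective (Y := Y')
    rw [← h]; simp

theorem epi_of_mono_transpose [RigidCategory C] {X X' Y Y' : C}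
    [ExactPairing X X'] [ExactPairing Y Y']
    {f : X ⟶ Y} {g : Y' ⟶ X'} (h : g ▷ X ≫ ε_ X X' = Y' ◁ f ≫ ε_ Y Y') [Mono g] : Epi f := by
  refine Preadditive.epi_of_cancel_zero f fun {Z} k hk => ?_
  obtain ⟨k', hk'⟩ := exists_transpose_left (Y' := Zᘁ) (X' := Y') k
  have := (transpose_eq_zero_iff (transpose_comp h hk')).1 hk
  exact (transpose_eq_zero_iff hk').2 (Limits.zero_of_comp_mono g this)

theorem mono_of_epi_transpose [RigidCategory C] {X X' Y Y' : C}
    [ExactPairing X X'] [ExactPairing Y Y']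
    {f : X ⟶ Y} {g : Y' ⟶ X'} (h : g ▷ X ≫ ε_ X X' = Y' ◁ f ≫ ε_ Y Y') [Epi f] : Mono g := by
  refine Preadditive.mono_of_cancel_zero g fun {Z'} k hk => ?_
  obtain ⟨k', hk'⟩ := exists_transpose_right (X := Y) (Y := (ᘁZ' : C)) k
  have := (transpose_eq_zero_iff (transpose_comp h hk')).2 hk
  exact (transpose_eq_zero_iff hk').1 (Limits.zero_of_epi_comp f this)

end Dual

/-- An object with a simple right dual is simple. -/
theorem simple_of_exactPairing {C : Type u} [Category.{v} C] [Abelian C] [MonoidalCategory C]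
    [MonoidalPreadditive C] [RigidCategory C] {X Y : C} [ExactPairing X Y] [Simple Y] :
    Simple X := by
  -- An epi out of `X` transposes to a mono into the simple `Y`, which is zero or an isomorphism.
  refine simple_of_cosimple X fun {Z} f _ => ⟨?_, fun hf => ?_⟩
  · rintro hf rfl
    have hX : 𝟙 X = 0 := by rw [← IsIso.hom_inv_id (0 : X ⟶ Z), Limits.zero_comp]
    exact id_nonzero Y ((transpose_eq_zero_iff (X := X) (Y := X) (g := 𝟙 Y) (by simp)).1 hX)
  · obtain ⟨g, hg⟩ := exists_transpose_left (X' := Y) (Y' := Zᘁ) f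
    have := mono_of_epi_transpose hg
    have := isIso_of_mono_of_nonzero (mt (transpose_eq_zero_iff hg).2 hf)
    exact isIso_of_isIso_transpose hg

/-! ### The form `K`, the morphism `d`, and the datum axioms. -/

section Datum

variable {C : Type u} [Category.{v} C] [Preadditive C] [MonoidalCategory C]
  [SymmetricCategory C] [RigidCategory C]

namespace IsSymmetrizableDatum

variable {X : OperadicLieAlgebra C} {V : C} {ρ : X.obj ⊗ V ⟶ V} {K : X.obj ⊗ X.obj ⟶ 𝟙_ C}

/-- Symmetry of `K` moves `f` to the first slot, where `formToDual` acts. -/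
theorem whiskerLeft_form (h : IsSymmetrizableDatum X ρ K) {A : C} (f : A ⟶ X.obj) :
    X.obj ◁ f ≫ K =
      (β_ A X.obj).inv ≫ (f ≫ formToDual K) ▷ X.obj ≫ ε_ X.obj (X.objᘁ) := by
  rw [comp_whiskerRight, Category.assoc, formToDual_evaluation, Iso.eq_inv_comp,
    ← BraidedCategory.braiding_naturality_left_assoc, h.symmetric]

theorem form_injective (h : IsSymmetrizableDatum X ρ K) {A : C} {f g : A ⟶ X.obj}
    (hfg : X.obj ◁ f ≫ K = X.obj ◁ g ≫ K) : f = g := by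
  have := h.nondegenerate
  rw [h.whiskerLeft_form, h.whiskerLeft_form, cancel_epi] at hfg
  exact (cancel_mono _).1 (whiskerRight_evaluation_injective hfg)

theorem form_d (h : IsSymmetrizableDatum X ρ K) :
    X.obj ◁ h.d ≫ K = (α_ X.obj V Vᘁ).inv ≫ ρ ▷ Vᘁ ≫ evSwap V := by
  have := h.nondegenerate
  rw [h.whiskerLeft_form, d, Category.assoc, IsIso.inv_hom_id, Category.comp_id,
    toDual_evaluation, Iso.inv_hom_id_assoc]

theorem form_d_assoc (h : IsSymmetrizableDatum X ρ K) {A : C} (f : A ⟶ V ⊗ Vᘁ) :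
    X.obj ◁ (f ≫ h.d) ≫ K = X.obj ◁ f ≫ (α_ X.obj V Vᘁ).inv ≫ ρ ▷ Vᘁ ≫ evSwap V := by
  rw [MonoidalCategory.whiskerLeft_comp, Category.assoc, h.form_d]

theorem form_eq_iff (h : IsSymmetrizableDatum X ρ K) (d' : V ⊗ Vᘁ ⟶ X.obj) :
    X.obj ◁ d' ≫ K = (α_ X.obj V Vᘁ).inv ≫ ρ ▷ Vᘁ ≫ evSwap V ↔ d' = h.d := by
  refine ⟨fun hd => h.form_injective (hd.trans h.form_d.symm), ?_⟩
  rintro rfl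
  exact h.form_d

variable [MonoidalPreadditive C]

theorem compatible (h : IsSymmetrizableDatum X ρ K) :
    X.obj ◁ h.d ≫ X.bracket =
    (α_ X.obj V Vᘁ).inv ≫ ρ ▷ Vᘁ ≫ h.d +
      (α_ X.obj V Vᘁ).inv ≫ (β_ X.obj V).hom ▷ Vᘁ ≫ (α_ V X.obj Vᘁ).hom ≫
        V ◁ coAction ρ ≫ h.d := by
  apply h.form_injective
  have hsub : (𝟙 (X.obj ⊗ X.obj) - (β_ X.obj X.obj).hom) ▷ V =
      𝟙 _ - (β_ X.obj X.obj).hom ▷ V := by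
    rw [← id_whiskerRight (X.obj ⊗ X.obj)]; exact (tensorRight V).map_sub
  have hsub' : ∀ {A B : C} (f g : A ⟶ B), (f - g) ▷ Vᘁ = f ▷ Vᘁ - g ▷ Vᘁ :=
    fun _ _ => (tensorRight Vᘁ).map_sub
  have h₁ : X.obj ◁ (X.obj ◁ h.d ≫ X.bracket) ≫ K =
      (α_ X.obj X.obj (V ⊗ Vᘁ)).inv ≫ (α_ (X.obj ⊗ X.obj) V Vᘁ).inv ≫
        (X.bracket ▷ V ≫ ρ) ▷ Vᘁ ≫ evSwap V := by
    calc
      _ = X.obj ◁ X.obj ◁ h.d ≫ (α_ _ _ _).inv ≫ X.bracket ▷ X.obj ≫ K := by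
        rw [h.invariant]; simp
      _ = (α_ X.obj X.obj (V ⊗ Vᘁ)).inv ≫ X.bracket ▷ (V ⊗ Vᘁ) ≫ X.obj ◁ h.d ≫ K := by
        rw [← whisker_exchange_assoc]; simp
      _ = _ := by rw [h.form_d]; simp
  have h₂ : X.obj ◁ ((α_ X.obj V Vᘁ).inv ≫ (β_ X.obj V).hom ▷ Vᘁ ≫ (α_ V X.obj Vᘁ).hom ≫
        V ◁ coAction ρ) ≫ (α_ X.obj V Vᘁ).inv ≫ ρ ▷ Vᘁ ≫ evSwap V =
      -((α_ X.obj X.obj (V ⊗ Vᘁ)).inv ≫ (α_ (X.obj ⊗ X.obj) V Vᘁ).inv ≫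
        ((β_ X.obj X.obj).hom ▷ V ≫ (α_ X.obj X.obj V).hom ≫ X.obj ◁ ρ ≫ ρ) ▷ Vᘁ ≫
          evSwap V) := by
    -- Both sides are `y ⊗ x ⊗ v ↦ yv ⊗ x`; the right one ends in the braiding that
    -- `coAction_evSwap` absorbs.
    have hβ : X.obj ◁ (β_ X.obj V).hom ≫ (α_ X.obj V X.obj).inv ≫ ρ ▷ X.obj =
        (α_ X.obj X.obj V).inv ≫ (β_ X.obj X.obj).hom ▷ V ≫ (α_ X.obj X.obj V).hom ≫
          X.obj ◁ ρ ≫ (β_ X.obj V).hom := by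
      simp [BraidedCategory.braiding_tensor_right_hom, ← comp_whiskerRight_assoc]
    calc
      _ = 𝟙 _ ⊗≫ X.obj ◁ (β_ X.obj V).hom ▷ Vᘁ ⊗≫
          ((X.obj ⊗ V) ◁ coAction ρ ≫ ρ ▷ Vᘁ) ⊗≫ evSwap V := by monoidal
      _ = 𝟙 _ ⊗≫ (X.obj ◁ (β_ X.obj V).hom ≫ (α_ X.obj V X.obj).inv ≫ ρ ▷ X.obj) ▷ Vᘁ ⊗≫
          V ◁ coAction ρ ≫ evSwap V := by
        rw [whisker_exchange]; monoidal
      _ = 𝟙 _ ⊗≫ ((α_ X.obj X.obj V).inv ≫ (β_ X.obj X.obj).hom ▷ V ≫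
          (α_ X.obj X.obj V).hom ≫ X.obj ◁ ρ) ▷ Vᘁ ≫
            ((β_ X.obj V).hom ▷ Vᘁ ≫ (α_ V X.obj Vᘁ).hom ≫ V ◁ coAction ρ ≫ evSwap V) := by
        rw [hβ]; monoidal
      _ = _ := by
        rw [coAction_evSwap]; simp [monoidalComp]
  rw [h₁, h.isModule, hsub]
  simp only [MonoidalPreadditive.whiskerLeft_add, Preadditive.add_comp]
  have h₃ := h.form_d_assoc ((α_ X.obj V Vᘁ).inv ≫ ρ ▷ Vᘁ)
  have h₄ := (h.form_d_assoc ((α_ X.obj V Vᘁ).inv ≫ (β_ X.obj V).hom ▷ Vᘁ ≫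
    (α_ V X.obj Vᘁ).hom ≫ V ◁ coAction ρ)).trans h₂
  simp only [Category.assoc] at h₃ h₄
  rw [h₃, h₄, Preadditive.sub_comp, hsub', Preadditive.sub_comp, Preadditive.comp_sub,
    Preadditive.comp_sub, sub_eq_add_neg]
  congr 1
  simp

theorem restrict_left (h : IsSymmetrizableDatum X ρ K) {S : C} [Simple S] (i : S ⟶ V) [Mono i] :
    i ▷ Vᘁ ≫ h.d ≠ 0 := by
  intro hd
  apply h.simple_sub S i
  apply evSwap_injective
  have := h.form_d_assoc (i ▷ Vᘁ)
  rw [hd] at this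
  rw [← cancel_epi (α_ X.obj S Vᘁ).inv]
  simpa using this.symm

end IsSymmetrizableDatum

theorem IsSymmetrizableDatum.restrict_right {C : Type u} [Category.{v} C] [Abelian C]
    [MonoidalCategory C] [MonoidalPreadditive C] [SymmetricCategory C] [RigidCategory C]
    {X : OperadicLieAlgebra C} {V : C} {ρ : X.obj ⊗ V ⟶ V} {K : X.obj ⊗ X.obj ⟶ 𝟙_ C}
    (h : IsSymmetrizableDatum X ρ K) {T : C} [Simple T] (j : T ⟶ Vᘁ) [Mono j] :
    V ◁ j ≫ h.d ≠ 0 := by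
  intro hd
  -- `T` is the right dual of `ᘁT`, so `j` is the transpose of some `p : V ⟶ ᘁT`, the simple
  -- quotient to test.
  obtain ⟨p, hp⟩ := exists_transpose_right (X := V) (Y := (ᘁT : C)) j
  have := simple_of_exactPairing (X := (ᘁT : C)) (Y := T)
  have := epi_of_mono_transpose hp
  apply h.simple_quotient (ᘁT : C) p
  apply whiskerLeft_evaluation_injective (Y := T)
  have h₁ := h.form_d_assoc (V ◁ j)
  rw [hd] at h₁
  have h₂ : X.obj ◁ V ◁ j ≫ (α_ X.obj V Vᘁ).inv ≫ ρ ▷ Vᘁ ≫ evSwap V =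
      (α_ X.obj V T).inv ≫ (β_ (X.obj ⊗ V) T).hom ≫ T ◁ (ρ ≫ p) ≫ ε_ (ᘁT : C) T := by
    rw [MonoidalCategory.whiskerLeft_comp, Category.assoc, ← hp, evSwap,
      BraidedCategory.braiding_naturality_left_assoc, whisker_exchange_assoc,
      ← BraidedCategory.braiding_naturality_right_assoc]
    simp
  rw [h₂] at h₁
  rw [← cancel_epi (β_ (X.obj ⊗ V) T).hom, ← cancel_epi (α_ X.obj V T).inv]
  simpa using h₁.symm

end Datum

end Contragredient

theorem mainTheorem6 {𝕜 : Type*} [Field 𝕜] [IsAlgClosed 𝕜]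
    {C : Type*} [Category C] [Abelian C] [Linear 𝕜 C]
    [MonoidalCategory C] [MonoidalPreadditive C] [MonoidalLinear 𝕜 C]
    [SymmetricCategory C] [RigidCategory C]
    (_hunit : Module.finrank 𝕜 (𝟙_ C ⟶ 𝟙_ C) = 1)
    (X : Contragredient.OperadicLieAlgebra C) {V : C} (ρ : X.obj ⊗ V ⟶ V)
    (K : X.obj ⊗ X.obj ⟶ 𝟙_ C) (h : Contragredient.IsSymmetrizableDatum X ρ K) :
    Contragredient.IsReducedContragredientDatum X ρ h.d ∧
      ∀ d' : V ⊗ Vᘁ ⟶ X.obj,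
        X.obj ◁ d' ≫ K = (α_ X.obj V (Vᘁ)).inv ≫ ρ ▷ Vᘁ ≫ Contragredient.evSwap V ↔
          d' = h.d := by
  exact ⟨
    { isModule := h.isModule
      compatible := h.compatible
      restrict_left := fun _ _ i _ => h.restrict_left i
      restrict_right := fun _ _ j _ => h.restrict_right j },
    h.form_eq_iff⟩
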